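/- Let a finite set $\mathcal V$ of individuals be split into followers $\mathcal V_F$ and leaders $\mathcal V_L$, with states $q_i(t)\in\mathbb R^d$. Let $\delta>0$, $k>0$, $\alpha\in(0,1]$, and $K_i>0$ for $i\in\mathcal V_F$. Put $S_{ij}=\|q_i-q_j\|^2$ (the social difference). The neighbor set of $i$ at time $t$ is $\mathcal N_i=\{j\ne i : S_{ij}\le\delta\}$, and $\mathcal G(t)$ is the directed graph on $\mathcal V$ whose edges are the pairs $(i,j)$ with $i\in\mathcal V_F$ and $j\in\mathcal N_i$ at time $t$; the edge $(i,j)$ means that $j$ influences $i$ ($j$ is a parent of $i$), and directed paths are followed from the influencing to the influenced node. For a follower $i$ let $$\varphi_i=\frac{\gamma_i}{(\gamma_i^k+\beta_i)^{1/k}},\qquad \gamma_i=\sum_{j\in\mathcal N_i}\tfrac12\|q_i-q_j\|^2,\qquad \beta_i=\tfrac12\prod_{j\in\mathcal N_i}(\delta-S_{ij}),$$ and let $\nabla_{q_i}\varphi_i$ be the gradient of $\varphi_i$ in the variable $q_i$, with the other states and the current set $\mathcal N_i$ held fixed. Let $q$ be a solution on $[0,\infty)$ of $${}_0D_t^\alpha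 q_i=-K_i\nabla_{q_i}\varphi_i\ (i\in\mathcal V_F),\qquad {}_0D_t^\alpha q_i=0\ (i\in\mathcal V_L),$$ where ${}_0D_t^\alpha$ is the Caputo derivative ${}_0D_t^\alpha x=\frac{d}{dt}\,{}_0I_t^{1-\alpha}(x-x(0))$, with ${}_0I_t^{\mu}$ the Riemann–Liouville integral of order $\mu$ (${}_0I_t^0$ the identity); that is, each $q_i$ is continuous, ${}_0I_t^{1-\alpha}(q_i-q_i(0))$ is locally absolutely continuous, and the equations hold for almost every $t>0$. Assume that $\delta-S_{ij}(0)>0$ for every edge $(i,j)$ of $\mathcal G(0)$, and that for each follower $i$ some leader has a directed path to $i$ in $\mathcal G(0)$. Then every edge $(i,j)$ of $\mathcal G(0)$ is kept: $S_{ij}(t)\le\delta$, so $(i,j)$ is an edge of $\mathcal G(t)$, for all $t\ge0$. Consequently, $\mathcal G(0)$ has a directed spanning tree rooted at the set of leaders (a subgraph in which every follower has exactly one parent, leaders have no parent, and every follower is reached by a directed path from some leader), and every such tree of $\mathcal G(0)$ is also one of $\mathcal G(t)$ for all $t\ge0$. -/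

import Mathlib

open MeasureTheory Set

noncomputable section

namespace SocialNetwork

/-! ### Fractional calculus on `[0, ∞)` -/

section Fractional

variable {E : Type*} [NormedAddCommGroup E] [NormedSpace ℝ E]

/-- Riemann–Liouville fractional integral of order `μ ≥ 0` with base point `0`:
`(1 / Γ(μ)) ∫₀ᵗ (t - s)^(μ - 1) f(s) ds` for `μ > 0`, and `f(t)` for `μ = 0`. -/
def fracIntegral (μ : ℝ) (f : ℝ → E) (t : ℝ) : E :=
  if μ = 0 then f t
  else (Real.Gamma μ)⁻¹ • ∫ s in (0 : ℝ)..t, (t - s) ^ (μ - 1) • f s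

/-- `x` solves `₀D_t^α x = u` on `[0, ∞)`, where `₀D_t^α x = d/dt (₀I_t^(1-α) (x - x(0)))` is the
Caputo derivative of order `α ∈ (0, 1]`: `x` is continuous, `₀I_t^(1-α) (x - x(0))` is locally
absolutely continuous, and its derivative is `u t` for almost every `t > 0`.
For `α = 1` this is the Carathéodory sense of `x' = u`. -/
structure HasCaputoDeriv (α : ℝ) (x u : ℝ → E) : Prop where
  continuousOn : ContinuousOn x (Ici 0)
  absolutelyContinuous : ∀ T : ℝ, 0 < T →
    AbsolutelyContinuousOnInterval (fracIntegral (1 - α) fun s => x s - x 0) 0 T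
  hasDerivAt : ∀ᵐ t : ℝ, 0 < t →
    HasDerivAt (fracIntegral (1 - α) fun s => x s - x 0) (u t) t

end Fractional

/-! ### Social interaction graph -/

section Network

variable {V : Type*} {d : ℕ}

/-- The social difference `S_ij = ‖q_i - q_j‖²` in the configuration `q`. -/
def socialDiff (q : V → EuclideanSpace ℝ (Fin d)) (i j : V) : ℝ := ‖q i - q j‖ ^ 2

/-- The directed interaction graph in the configuration `q`, with follower set `F` and threshold
`δ`. The edge `(i, j)` means that `i` accesses the state of `j` (so `j` influences `i`); leaders,
that is, the nodes outside `F`, are not influenced by anybody. -/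
def graph (F : Finset V) (δ : ℝ) (q : V → EuclideanSpace ℝ (Fin d)) : Digraph V where
  Adj i j := i ∈ F ∧ j ≠ i ∧ socialDiff q i j ≤ δ

/-- There is a directed path of influence from `a` to `b` in `G`: a nonempty chain of nodes from
`a` to `b` in which every node influences the next one. -/
def InfluencePath (G : Digraph V) (a b : V) : Prop :=
  Relation.TransGen (fun x y => G.Adj y x) a b

/-- `T` is a directed spanning tree of `G` in which the set of leaders (the nodes outside `F`) acts
as the root: `T` is a subgraph of `G`, every follower has exactly one parent in `T`, leaders have
no parent, and every follower is reached by a directed path in `T` from some leader. -/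
structure IsSpanningTree (F : Finset V) (G T : Digraph V) : Prop where
  le : T ≤ G
  existsUnique_parent : ∀ i ∈ F, ∃! j, T.Adj i j
  leader_no_parent : ∀ i, i ∉ F → ∀ j, ¬ T.Adj i j
  reachable : ∀ i ∈ F, ∃ l, l ∉ F ∧ InfluencePath T l i

variable [Fintype V]

open Classical in
/-- The neighbor set `N_i = {j ≠ i | S_ij ≤ δ}` in the configuration `q`. -/
def neighbors (δ : ℝ) (q : V → EuclideanSpace ℝ (Fin d)) (i : V) : Finset V :=
  Finset.univ.filter fun j => j ≠ i ∧ socialDiff q i j ≤ δ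

/-! ### Potential function and influence law -/

/-- Goal function `γ_i`, as a function of the own state `x`, for the neighbor set `N`. -/
def goal (N : Finset V) (q : V → EuclideanSpace ℝ (Fin d)) (x : EuclideanSpace ℝ (Fin d)) : ℝ :=
  ∑ j ∈ N, (1 / 2 : ℝ) * ‖x - q j‖ ^ 2

/-- Constraint function `β_i = (1/2) ∏ (δ - S_ij)`, as a function of the own state `x`, for the
neighbor set `N`. -/
def constraint (δ : ℝ) (N : Finset V) (q : V → EuclideanSpace ℝ (Fin d))
    (x : EuclideanSpace ℝ (Fin d)) : ℝ :=
  (1 / 2 : ℝ) * ∏ j ∈ N, (δ - ‖x - q j‖ ^ 2)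

/-- The potential `φ_i = γ_i / (γ_i^k + β_i)^(1/k)`, as a function of the own state `x`. -/
def potential (δ k : ℝ) (N : Finset V) (q : V → EuclideanSpace ℝ (Fin d))
    (x : EuclideanSpace ℝ (Fin d)) : ℝ :=
  goal N q x / (goal N q x ^ k + constraint δ N q x) ^ (1 / k)

open Classical in
/-- The influence `u_i` in the configuration `q`: `-K_i ∇_{q_i} φ_i` for a follower, where `φ_i`
is built on the current neighbors of `i`, and zero for a leader. -/
def influence (F : Finset V) (δ k : ℝ) (K : V → ℝ) (q : V → EuclideanSpace ℝ (Fin d)) (i : V) :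
    EuclideanSpace ℝ (Fin d) :=
  if i ∈ F then -(K i • gradient (potential δ k (neighbors δ q i) q) (q i)) else 0

/-- The trajectory `q` (`q t i` is the state of `i` at time `t`) solves the closed-loop dynamics
`₀D_t^α q_i = u_i` on `[0, ∞)`. -/
def IsClosedLoop (F : Finset V) (α δ k : ℝ) (K : V → ℝ)
    (q : ℝ → V → EuclideanSpace ℝ (Fin d)) : Prop :=
  ∀ i, HasCaputoDeriv α (fun t => q t i) fun t => influence F δ k K (q t) i

end Network

end SocialNetwork

end

/-!
The edges of the initial graph are kept because every bond `b = δ - ‖q_i - q_j‖²` acts as a barrier.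
Differentiating the potential shows that, on its neighbors, the influence is
`u_i = -∑ w_il (q_i - q_l)` with weights `w_il ≥ 0` that are bounded uniformly over all
configurations and all neighbor sets, and that for `l ≠ j` the weight `w_il` contains the factor
`δ - ‖q_i - q_j‖²`. Hence `⟪q_i - q_j, u_i - u_j⟫ ≤ C b` whenever `b ≥ 0`
(`exists_influence_bound`): at the boundary of the bond, the influences do not separate the pair.
The constant survives every change of the neighbor sets, so the discontinuity of the closed loop at
such changes is harmless, and each edge can be treated on its own.

It remains to see that `y = q_i - q_j` with `⟪y, v⟫ ≤ C (δ - ‖y‖²)`, where `v` is a bounded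
Caputo derivative of `y`, cannot leave the open ball of radius `√δ` (`norm_sub_sq_lt_of_inner_le`).
For `α = 1`, `b' ≥ -2 C b` almost everywhere, and `b exp (2 C t)` is nondecreasing. For `α < 1`, let
`T` be the first exit time and project on `e = y T`. The scalar function `⟪e, y⟫` attains its strict
maximum over `[0, T]` at `T`, while its Caputo derivative `⟪e, v⟫` is at most `ε` shortly before
`T`, for every `ε > 0`. But the Caputo derivative has memory: at a maximum it is at least a positive
multiple of the total increase since time `0`. That extremum principle is `exists_lt_powConv_sub`.
The function is only continuous and the equation holds only almost everywhere, so the principle is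
first shown at a maximum with a one-sided Lipschitz bound (`le_powConv_sub_powConv`) and then
transferred by averaging over a short time window, which commutes with the fractional integral.

The spanning tree is a breadth-first tree: each follower chooses a parent closer to the leaders.
-/

noncomputable section

namespace SocialNetwork

/-! ### Absolutely continuous functions -/

/-- Integrated form of an almost everywhere upper bound `c` on the derivative. -/
theorem sub_le_of_ae_hasDerivAt_le {f : ℝ → ℝ} {a b c : ℝ} (hab : a ≤ b)
    (hf : AbsolutelyContinuousOnInterval f a b)
    (h : ∀ᵐ t : ℝ, t ∈ Ioo a b → ∃ v ≤ c, HasDerivAt f v t) :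
    f b - f a ≤ c * (b - a) := by
  rw [← hf.integral_deriv_eq_sub]
  have hc : c * (b - a) = ∫ _ in a..b, c := by simp [mul_comm]
  rw [hc]
  refine intervalIntegral.integral_mono_ae_restrict hab hf.intervalIntegrable_deriv
    intervalIntegrable_const ?_
  rw [Filter.EventuallyLE, ← Measure.restrict_congr_set Ioo_ae_eq_Icc,
    ae_restrict_iff' measurableSet_Ioo]
  filter_upwards [h] with t ht htm
  obtain ⟨v, hv, hd⟩ := ht htm
  rwa [hd.deriv]

/-- Covers Lipschitz images of an absolutely continuous function, in particular its coordinates and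
projections, and does not see additive constants. -/
theorem absolutelyContinuousOnInterval_of_dist_le {E E' : Type*} [PseudoMetricSpace E]
    [PseudoMetricSpace E'] {f : ℝ → E} {g : ℝ → E'} {a b C : ℝ}
    (hf : AbsolutelyContinuousOnInterval f a b)
    (h : ∀ s t, dist (g s) (g t) ≤ C * dist (f s) (f t)) :
    AbsolutelyContinuousOnInterval g a b := by
  refine squeeze_zero (fun _ => Finset.sum_nonneg fun _ _ => dist_nonneg)
    (fun E => ?_) (by simpa using! Filter.Tendsto.const_mul C hf)
  rw [Finset.mul_sum]
  exact Finset.sum_le_sum fun _ _ => h _ _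

/-! ### An extremum principle for fractional derivatives -/

/-- The convolution of `f` with the kernel `r ^ (-α)` on `[0, R]`. For `f` vanishing on `(-∞, 0]` and
`0 ≤ t ≤ R` it is `Γ(1 - α)` times the fractional integral of order `1 - α` at `t`; the fixed upper
limit makes it commute with translations of `f`. -/
def powConv (α R : ℝ) (f : ℝ → ℝ) (t : ℝ) : ℝ := ∫ r in (0 : ℝ)..R, r ^ (-α) * f (t - r)

theorem intervalIntegrable_rpow_neg_mul {α : ℝ} (hα1 : α < 1) {f : ℝ → ℝ} (hf : Continuous f)
    (a b : ℝ) : IntervalIntegrable (fun r => r ^ (-α) * f r) volume a b :=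
  (intervalIntegral.intervalIntegrable_rpow' (by linarith)).mul_continuousOn hf.continuousOn

/-- Extremum principle at a maximum `t₀` with one-sided Lipschitz constant `L`: over a step `τ`,
the convolution increases by at least a multiple of `τ * f t₀`, up to an error of order
`τ ^ (2 - α)`. In terms of `n r = f t₀ - f (t₀ - r) ≥ 0`, the increase is the integral of
`r ^ (-α) * (n (r + τ) - n r)`; replacing the first `r ^ (-α)` by the smaller `(r + τ) ^ (-α)` makes
it telescope to the difference of the integrals of `r ^ (-α) * n r` over `[R, R + τ]`, where
`n = f t₀`, and over `[0, τ]`, where `n ≤ L * τ`. -/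
theorem le_powConv_sub_powConv {α R : ℝ} (hα : 0 < α) (hα1 : α < 1) (hR : 0 < R)
    {f : ℝ → ℝ} (hf : Continuous f) (h0 : ∀ t ≤ 0, f t = 0) {t₀ : ℝ} (ht₀ : t₀ ≤ R)
    (hmax : ∀ t ≤ t₀, f t ≤ f t₀) {L : ℝ} (hL : ∀ r, 0 ≤ r → f t₀ - f (t₀ - r) ≤ L * r)
    {τ : ℝ} (hτ : 0 < τ) (hτR : τ ≤ R) :
    τ * ((2 * R) ^ (-α) * f t₀) - L * τ * (τ ^ (1 - α) / (1 - α))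
      ≤ powConv α R f t₀ - powConv α R f (t₀ - τ) := by
  set n : ℝ → ℝ := fun r => f t₀ - f (t₀ - r) with hn
  have hnc : Continuous n := by fun_prop
  have hnn : ∀ r, 0 ≤ r → 0 ≤ n r := fun r hr => sub_nonneg.2 (hmax _ (by linarith))
  have hI := intervalIntegrable_rpow_neg_mul hα1 hnc
  have hIτ := intervalIntegrable_rpow_neg_mul hα1 (f := fun r => n (r + τ)) (by fun_prop)
  have h1 : powConv α R f t₀ - powConv α R f (t₀ - τ)
      = (∫ r in (0 : ℝ)..R, r ^ (-α) * n (r + τ)) - ∫ r in (0 : ℝ)..R, r ^ (-α) * n r := by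
    unfold powConv
    rw [← intervalIntegral.integral_sub (hIτ 0 R) (hI 0 R),
      ← intervalIntegral.integral_sub
        (intervalIntegrable_rpow_neg_mul hα1 (f := fun r => f (t₀ - r)) (by fun_prop) 0 R)
        (intervalIntegrable_rpow_neg_mul hα1 (f := fun r => f (t₀ - τ - r)) (by fun_prop) 0 R)]
    refine intervalIntegral.integral_congr fun r _ => ?_
    have : t₀ - τ - r = t₀ - (r + τ) := by ring
    simp only [hn, this]
    ring
  have h2 : ∫ r in τ..(R + τ), r ^ (-α) * n r ≤ ∫ r in (0 : ℝ)..R, r ^ (-α) * n (r + τ) := by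
    have := intervalIntegral.integral_comp_add_right (a := 0) (b := R)
      (fun r => r ^ (-α) * n r) τ
    rw [zero_add] at this
    rw [← this]
    refine intervalIntegral.integral_mono_on_of_le_Ioo hR.le ?_ (hIτ 0 R) fun r hr => ?_
    · have := (hI τ (R + τ)).comp_add_right τ
      simpa using this
    · exact mul_le_mul_of_nonneg_right
        (Real.rpow_le_rpow_of_nonpos hr.1 (by linarith) (by linarith))
        (hnn _ (by linarith [hr.1]))
  have h3 : (∫ r in τ..(R + τ), r ^ (-α) * n r) - ∫ r in (0 : ℝ)..R, r ^ (-α) * n r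
      = (∫ r in R..(R + τ), r ^ (-α) * n r) - ∫ r in (0 : ℝ)..τ, r ^ (-α) * n r := by
    have e1 := intervalIntegral.integral_add_adjacent_intervals (hI 0 τ) (hI τ (R + τ))
    have e2 := intervalIntegral.integral_add_adjacent_intervals (hI 0 R) (hI R (R + τ))
    linarith
  have h4 : τ * ((2 * R) ^ (-α) * f t₀) ≤ ∫ r in R..(R + τ), r ^ (-α) * n r := by
    have : τ * ((2 * R) ^ (-α) * f t₀) = ∫ _ in R..(R + τ), (2 * R) ^ (-α) * f t₀ := by
      simp only [intervalIntegral.integral_const, smul_eq_mul]; ring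
    rw [this]
    refine intervalIntegral.integral_mono_on (by linarith) intervalIntegrable_const
      (hI _ _) fun r hr => ?_
    have hnr : n r = f t₀ := by simp [hn, h0 (t₀ - r) (by linarith [hr.1])]
    rw [hnr]
    refine mul_le_mul_of_nonneg_right
        (Real.rpow_le_rpow_of_nonpos (by linarith [hr.1]) (by linarith [hr.2]) (by linarith)) ?_
    rw [← hnr]
    exact hnn r (by linarith [hr.1])
  have h5 : ∫ r in (0 : ℝ)..τ, r ^ (-α) * n r ≤ L * τ * (τ ^ (1 - α) / (1 - α)) := by
    have : L * τ * (τ ^ (1 - α) / (1 - α)) = ∫ r in (0 : ℝ)..τ, r ^ (-α) * (L * τ) := by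
      rw [intervalIntegral.integral_mul_const, integral_rpow (Or.inl (by linarith)),
        Real.zero_rpow (by linarith), show -α + 1 = 1 - α by ring]
      ring
    rw [this]
    refine intervalIntegral.integral_mono_on hτ.le (hI _ _)
      (intervalIntegrable_rpow_neg_mul hα1 continuous_const _ _) fun r hr => ?_
    refine mul_le_mul_of_nonneg_left ?_ (Real.rpow_nonneg hr.1 _)
    have hLn : 0 ≤ L := by
      have := (hnn 1 zero_le_one).trans (hL 1 zero_le_one)
      linarith
    exact (hL r hr.1).trans (mul_le_mul_of_nonneg_left hr.2 hLn)
  linarith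

theorem continuous_powConv {α : ℝ} (hα1 : α < 1) (R : ℝ) {f : ℝ → ℝ} (hf : Continuous f)
    {B : ℝ} (hB : ∀ t, |f t| ≤ B) : Continuous (powConv α R f) := by
  unfold powConv
  refine intervalIntegral.continuous_of_dominated_interval (bound := fun r => |r ^ (-α)| * B)
    (fun t => ?_) (fun t => ?_) ?_ ?_
  · exact (intervalIntegrable_iff.1 (intervalIntegrable_rpow_neg_mul hα1 (f := fun r => f (t - r))
      (by fun_prop) 0 R)).aestronglyMeasurable
  · refine Filter.Eventually.of_forall fun r _ => ?_
    rw [norm_mul]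
    exact mul_le_mul_of_nonneg_left (hB _) (abs_nonneg _)
  · exact (intervalIntegral.intervalIntegrable_rpow' (by linarith)).abs.mul_const B
  · exact Filter.Eventually.of_forall fun r _ => by fun_prop

/-- The mean of `f` over the time window `[t - σ, t]`. -/
def backwardAverage (σ : ℝ) (f : ℝ → ℝ) (t : ℝ) : ℝ := σ⁻¹ * ∫ s in (0 : ℝ)..σ, f (t - s)

/-- Fubini: averaging in time commutes with the convolution. -/
theorem powConv_backwardAverage {α : ℝ} (hα1 : α < 1) {R σ : ℝ} (hR : 0 ≤ R) (hσ : 0 ≤ σ)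
    {f : ℝ → ℝ} (hf : Continuous f) {B : ℝ} (hB : ∀ t, |f t| ≤ B) (t : ℝ) :
    powConv α R (backwardAverage σ f) t = backwardAverage σ (powConv α R f) t := by
  unfold powConv backwardAverage
  rw [← intervalIntegral.integral_const_mul]
  have e1 : ∀ r, r ^ (-α) * (σ⁻¹ * ∫ s in (0 : ℝ)..σ, f (t - r - s))
      = σ⁻¹ * ∫ s in (0 : ℝ)..σ, r ^ (-α) * f (t - s - r) := fun r => by
    rw [intervalIntegral.integral_const_mul]
    have : ∀ s, t - r - s = t - s - r := fun s => by ring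
    simp only [this]
    ring
  simp only [e1]
  rw [intervalIntegral.integral_const_mul, intervalIntegral.integral_const_mul]
  congr 1
  simp only [intervalIntegral.integral_of_le hR, intervalIntegral.integral_of_le hσ]
  refine integral_integral_swap ?_
  have hi : Integrable (fun r : ℝ => r ^ (-α)) (volume.restrict (Ioc 0 R)) := by
    have := intervalIntegral.intervalIntegrable_rpow' (a := 0) (b := R) (r := -α) (by linarith)
    rwa [intervalIntegrable_iff_integrableOn_Ioc_of_le hR] at this
  have h1 := hi.comp_fst (volume.restrict (Ioc (0 : ℝ) σ))
  refine h1.mul_bdd (c := B) ?_ ?_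
  · exact Continuous.aestronglyMeasurable (by fun_prop)
  · exact Filter.Eventually.of_forall fun p => hB _

theorem continuous_backwardAverage (σ : ℝ) {f : ℝ → ℝ} (hf : Continuous f) :
    Continuous (backwardAverage σ f) := by
  unfold backwardAverage
  exact continuous_const.mul
    (intervalIntegral.continuous_parametric_intervalIntegral_of_continuous' (by fun_prop) _ _)

theorem backwardAverage_le {σ c : ℝ} (hσ : 0 < σ) {f : ℝ → ℝ} (hf : Continuous f) {t : ℝ}
    (h : ∀ s ∈ Icc 0 σ, f (t - s) ≤ c) : backwardAverage σ f t ≤ c := by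
  have : ∫ s in (0 : ℝ)..σ, f (t - s) ≤ ∫ _ in (0 : ℝ)..σ, c :=
    intervalIntegral.integral_mono_on hσ.le
      (Continuous.intervalIntegrable (by fun_prop) _ _) intervalIntegrable_const h
  rw [intervalIntegral.integral_const, smul_eq_mul, sub_zero] at this
  unfold backwardAverage
  rwa [inv_mul_le_iff₀ hσ]

theorem backwardAverage_sub {σ : ℝ} {f : ℝ → ℝ} (hf : Continuous f) (t τ : ℝ) :
    backwardAverage σ f t - backwardAverage σ f (t - τ)
      = backwardAverage σ (fun s => f s - f (s - τ)) t := by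
  unfold backwardAverage
  rw [← mul_sub, ← intervalIntegral.integral_sub
    (Continuous.intervalIntegrable (by fun_prop) _ _)
    (Continuous.intervalIntegrable (by fun_prop) _ _)]
  simp only [sub_right_comm]

theorem backwardAverage_sub_le {σ B : ℝ} (hσ : 0 < σ) {f : ℝ → ℝ} (hf : Continuous f)
    (hB : ∀ t, |f t| ≤ B) (t : ℝ) {r : ℝ} (hr : 0 ≤ r) :
    backwardAverage σ f t - backwardAverage σ f (t - r) ≤ 2 * B / σ * r := by
  have hi : ∀ a b, IntervalIntegrable f volume a b := fun a b => hf.intervalIntegrable a b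
  have key : (∫ s in (0 : ℝ)..σ, f (t - s)) - ∫ s in (0 : ℝ)..σ, f (t - r - s) ≤ 2 * B * r := by
    rw [intervalIntegral.integral_comp_sub_left, intervalIntegral.integral_comp_sub_left,
      sub_zero, sub_zero, intervalIntegral.integral_interval_sub_interval_comm' (hi _ _) (hi _ _)
        (hi _ _)]
    have b1 := intervalIntegral.norm_integral_le_of_norm_le_const (a := t - r) (b := t) (f := f)
      (C := B) fun s _ => hB s
    have b2 := intervalIntegral.norm_integral_le_of_norm_le_const (a := t - r - σ) (b := t - σ)
      (f := f) (C := B) fun s _ => hB s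
    rw [show t - (t - r) = r by ring, abs_of_nonneg hr, Real.norm_eq_abs] at b1
    rw [show t - σ - (t - r - σ) = r by ring, abs_of_nonneg hr, Real.norm_eq_abs] at b2
    linarith [(abs_le.1 b1).2, (abs_le.1 b2).1]
  unfold backwardAverage
  rw [← mul_sub, inv_mul_le_iff₀ hσ]
  refine key.trans (le_of_eq ?_)
  field_simp

/-- Extremum principle for the fractional derivative of a merely continuous function: if `f`, zero up
to time `0`, has a strict maximum over `(-∞, T]` at `T`, then the increments of its convolution
cannot be bounded by `ε * (t - s)` near `T` when `ε` is small. -/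
theorem exists_lt_powConv_sub {α : ℝ} (hα : 0 < α) (hα1 : α < 1) {T B : ℝ} (hT : 0 < T)
    {f : ℝ → ℝ} (hf : Continuous f) (hB : ∀ t, |f t| ≤ B) (h0 : ∀ t ≤ 0, f t = 0)
    (hmax : ∀ t < T, f t < f T) :
    ∃ ε > 0, ∀ η > 0, ∃ s t, T - η ≤ s ∧ s ≤ t ∧ t ≤ T ∧
      ε * (t - s) < powConv α T f t - powConv α T f s := by
  have hM : 0 < f T := by simpa [h0 0 le_rfl] using hmax 0 hT
  have hpT : 0 < (2 * T) ^ (-α) := Real.rpow_pos_of_pos (by linarith) _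
  refine ⟨(2 * T) ^ (-α) * f T / 4, by positivity, fun η hη => ?_⟩
  set ε := (2 * T) ^ (-α) * f T / 4 with hε
  have hε0 : 0 < ε := by positivity
  by_contra! hcon
  obtain ⟨ρ, hρ0, hρη, hρT⟩ : ∃ ρ > 0, ρ ≤ η ∧ ρ ≤ T := ⟨min η T, by positivity, by simp, by simp⟩
  set a := T - ρ / 2 with ha
  have ha0 : 0 ≤ a := by linarith
  obtain ⟨s₁, hs₁, hs₁m⟩ := isCompact_Icc.exists_isMaxOn (nonempty_Icc.2 ha0) hf.continuousOn
  have hs₁T : f s₁ < f T := hmax _ (by linarith [hs₁.2])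
  -- `m` separates the values of `f` near `T` from those before `a`, so that a maximum point of the
  -- average over a window `σ` also lies in `[a, T]`
  obtain ⟨m, hm1, hmT⟩ : ∃ m, max (f s₁) (f T / 2) < m ∧ m < f T :=
    exists_between (max_lt hs₁T (by linarith))
  have hfa : ∀ t ≤ a, f t ≤ max (f s₁) (f T / 2) := fun t ht => by
    rcases le_total t 0 with h | h
    · rw [h0 t h]; exact le_max_of_le_right (by linarith)
    · exact le_max_of_le_left (hs₁m ⟨h, ht⟩)
  obtain ⟨σ₀, hσ₀, hσ₀m⟩ : ∃ σ₀ > 0, ∀ t, |t - T| < σ₀ → m < f t := by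
    have := hf.continuousAt.eventually (lt_mem_nhds hmT)
    exact Metric.eventually_nhds_iff.1 this
  obtain ⟨σ, hσ, hσ1, hσρ⟩ : ∃ σ > 0, σ < σ₀ ∧ σ ≤ ρ / 4 :=
    ⟨min (σ₀ / 2) (ρ / 4), by positivity, by
      rw [min_lt_iff]; left; linarith, by simp⟩
  set F := backwardAverage σ f with hF
  have hFc : Continuous F := continuous_backwardAverage σ hf
  have hFT : m ≤ F T := by
    have := backwardAverage_le (f := fun s => - f s) (c := -m) (t := T) hσ hf.neg fun s hs =>
      neg_le_neg (hσ₀m _ (by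
        rw [show T - s - T = -s by ring, abs_neg, abs_of_nonneg hs.1]; linarith [hs.2])).le
    simp only [backwardAverage, intervalIntegral.integral_neg, mul_neg] at this
    exact neg_le_neg_iff.1 this
  have hFa : ∀ t ≤ a, F t ≤ max (f s₁) (f T / 2) := fun t ht =>
    backwardAverage_le hσ hf fun s hs => hfa _ (by linarith [hs.1])
  have hF0 : ∀ t ≤ 0, F t = 0 := fun t ht => by
    have : ∫ s in (0 : ℝ)..σ, f (t - s) = ∫ s in (0 : ℝ)..σ, (0 : ℝ) := by
      refine intervalIntegral.integral_congr fun s hs => h0 _ ?_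
      rw [uIcc_of_le hσ.le] at hs
      linarith [hs.1]
    simp [hF, backwardAverage, this]
  obtain ⟨t₀, ht₀, ht₀m⟩ := isCompact_Icc.exists_isMaxOn
    (nonempty_Icc.2 (show a ≤ T by linarith)) hFc.continuousOn
  have hFt₀ : m ≤ F t₀ := hFT.trans (ht₀m ⟨by linarith, le_rfl⟩)
  have hFmax : ∀ t ≤ t₀, F t ≤ F t₀ := fun t ht => by
    rcases le_total t a with h | h
    · exact (hFa t h).trans (hm1.le.trans hFt₀)
    · exact ht₀m ⟨h, ht.trans ht₀.2⟩
  have hFt₀2 : f T / 2 ≤ F t₀ := (le_max_right _ _).trans (hm1.le.trans hFt₀)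
  -- a step so small that the regularity error is below `ε`, possible since `1 - α > 0`
  obtain ⟨τ, hτ0, hτρ, hτε⟩ : ∃ τ > 0, τ ≤ ρ / 4 ∧ 2 * B / σ * (τ ^ (1 - α) / (1 - α)) < ε := by
    have hc : ContinuousAt (fun τ : ℝ => 2 * B / σ * (τ ^ (1 - α) / (1 - α))) 0 := by
      have := Real.continuousAt_rpow_const 0 (1 - α) (Or.inr (by linarith))
      exact continuousAt_const.mul (this.div_const _)
    have hc0 : 2 * B / σ * ((0 : ℝ) ^ (1 - α) / (1 - α)) < ε := by
      rw [Real.zero_rpow (by linarith)]; simpa using hε0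
    obtain ⟨w, hw, hwε⟩ := Metric.eventually_nhds_iff.1 (hc.eventually (gt_mem_nhds hc0))
    refine ⟨min (w / 2) (ρ / 4), by positivity, by simp, hwε ?_⟩
    have : 0 < min (w / 2) (ρ / 4) := by positivity
    rw [Real.dist_eq, sub_zero, abs_of_pos this, min_lt_iff]
    left; linarith
  have hlow := le_powConv_sub_powConv hα hα1 hT hFc hF0 ht₀.2 hFmax
    (fun r hr => backwardAverage_sub_le hσ hf hB t₀ hr) hτ0 (by linarith)
  have hup : powConv α T F t₀ - powConv α T F (t₀ - τ) ≤ ε * τ := by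
    rw [hF, powConv_backwardAverage hα1 hT.le hσ.le hf hB,
      powConv_backwardAverage hα1 hT.le hσ.le hf hB,
      backwardAverage_sub (continuous_powConv hα1 T hf hB)]
    have hPc := continuous_powConv hα1 T hf hB
    refine backwardAverage_le hσ (by fun_prop) fun s hs => ?_
    have := hcon (t₀ - s - τ) (t₀ - s) (by linarith [hs.2, ht₀.1]) (by linarith)
      (by linarith [hs.1, ht₀.2])
    rwa [show t₀ - s - (t₀ - s - τ) = τ by ring] at this
  have h1 := hlow.trans hup
  have h2 : (2 * T) ^ (-α) * f T / 2 ≤ (2 * T) ^ (-α) * F t₀ := by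
    rw [mul_div_assoc]
    exact mul_le_mul_of_nonneg_left hFt₀2 hpT.le
  have h3 : τ * (2 * ε) ≤ τ * ((2 * T) ^ (-α) * F t₀) :=
    mul_le_mul_of_nonneg_left (by linarith) hτ0.le
  have h4 : τ * (2 * B / σ * (τ ^ (1 - α) / (1 - α))) < τ * ε :=
    mul_lt_mul_of_pos_left hτε hτ0
  nlinarith

/-! ### Invariance of a ball under fractional dynamics -/

theorem exists_first_exit {S : ℝ → ℝ} {δ : ℝ} (hS : ContinuousOn S (Ici 0)) (h0 : S 0 < δ)
    {t : ℝ} (ht : 0 ≤ t) (hSt : δ ≤ S t) :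
    ∃ T > 0, S T = δ ∧ ∀ s, 0 ≤ s → s < T → S s < δ := by
  have hSc : ContinuousOn S (Icc 0 t) := hS.mono Icc_subset_Ici_self
  have hcl : IsCompact (Icc 0 t ∩ S ⁻¹' Ici δ) :=
    isCompact_Icc.of_isClosed_subset (hSc.preimage_isClosed_of_isClosed isClosed_Icc isClosed_Ici)
      inter_subset_left
  obtain ⟨T, ⟨hT, hTδ⟩, hleast⟩ := hcl.exists_isLeast ⟨t, ⟨ht, le_rfl⟩, hSt⟩
  have hlt : ∀ s, 0 ≤ s → s < T → S s < δ := fun s hs hsT => by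
    by_contra! h
    exact absurd (hleast ⟨⟨hs, hsT.le.trans hT.2⟩, h⟩) (not_le.2 hsT)
  have hT0 : 0 < T := hT.1.lt_of_ne fun h => by
    rw [← h] at hTδ; exact absurd h0 (not_lt.2 hTδ)
  refine ⟨T, hT0, le_antisymm ?_ hTδ, hlt⟩
  have hc : ContinuousWithinAt S (Iio T) T :=
    ((hS.continuousAt (Ici_mem_nhds hT0))).continuousWithinAt
  refine le_of_tendsto hc ?_
  filter_upwards [Ioo_mem_nhdsLT hT0] with s hs
  exact (hlt s hs.1.le hs.2).le

section Inner

variable {E : Type*} [NormedAddCommGroup E] [InnerProductSpace ℝ E] [CompleteSpace E]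

theorem inner_fracIntegral {α : ℝ} (hα1 : α < 1) {x : ℝ → E} (hx : ContinuousOn x (Ici 0))
    (e : E) {t : ℝ} (ht : 0 ≤ t) :
    inner ℝ e (fracIntegral (1 - α) x t)
      = (Real.Gamma (1 - α))⁻¹ * ∫ r in (0 : ℝ)..t, r ^ (-α) * inner ℝ e (x (t - r)) := by
  have hne : 1 - α ≠ 0 := by linarith
  simp only [fracIntegral, if_neg hne, inner_smul_right]
  congr 1
  have hsub := intervalIntegral.integral_comp_sub_left (a := 0) (b := t)
    (fun s => (t - s) ^ (1 - α - 1) • x s) t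
  simp only [sub_zero, sub_self, sub_sub_cancel] at hsub
  rw [← hsub]
  have hi : IntervalIntegrable (fun r => r ^ (1 - α - 1) • x (t - r)) volume 0 t := by
    refine (intervalIntegral.intervalIntegrable_rpow' (by linarith)).smul_continuousOn ?_
    refine hx.comp (by fun_prop) fun r hr => ?_
    rw [uIcc_of_le ht] at hr
    exact sub_nonneg.2 hr.2
  have := ((innerSL ℝ e).intervalIntegral_comp_comm hi).symm
  simp only [innerSL_apply_apply, inner_smul_right] at this
  rw [this]
  simp only [show 1 - α - 1 = -α by ring]

/-- At a first exit time `T` the projection on `x₁ T - x₂ T` has a strict maximum, which the extremum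
principle forbids, as its Caputo derivative is almost nonpositive just before `T`. -/
theorem not_first_exit_of_lt_one {α : ℝ} (hα : 0 < α) (hα1 : α < 1) {x₁ x₂ u₁ u₂ : ℝ → E}
    (h₁ : HasCaputoDeriv α x₁ u₁) (h₂ : HasCaputoDeriv α x₂ u₂) {δ C : ℝ}
    (hu : ∀ t, 0 ≤ t → ‖u₁ t - u₂ t‖ ≤ C)
    (hin : ∀ t, 0 ≤ t → ‖x₁ t - x₂ t‖ ^ 2 ≤ δ →
      inner ℝ (x₁ t - x₂ t) (u₁ t - u₂ t) ≤ C * (δ - ‖x₁ t - x₂ t‖ ^ 2))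
    {T : ℝ} (hT : 0 < T) (hTδ : ‖x₁ T - x₂ T‖ ^ 2 = δ)
    (hlt : ∀ s, 0 ≤ s → s < T → ‖x₁ s - x₂ s‖ ^ 2 < δ) : False := by
  set y : ℝ → E := fun t => x₁ t - x₂ t with hy
  have hyc : ContinuousOn y (Ici 0) := h₁.continuousOn.sub h₂.continuousOn
  set e := y T with he
  have heδ : ‖e‖ ^ 2 = δ := hTδ
  set g : ℝ → ℝ := fun t => inner ℝ e (y t) with hg
  have hgc : ContinuousOn g (Ici 0) := continuousOn_const.inner hyc
  have hgT : g T = δ := by rw [hg, ← heδ]; exact real_inner_self_eq_norm_sq e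
  have hglt : ∀ s, 0 ≤ s → s < T → g s < g T := fun s hs hsT => by
    have h1 : ‖y s‖ ^ 2 < ‖e‖ ^ 2 := heδ ▸ hlt s hs hsT
    have h2 : ‖y s‖ < ‖e‖ := lt_of_pow_lt_pow_left₀ 2 (norm_nonneg _) h1
    have h3 : 0 < ‖e‖ := (norm_nonneg _).trans_lt h2
    calc g s ≤ ‖e‖ * ‖y s‖ := real_inner_le_norm _ _
      _ < ‖e‖ * ‖e‖ := mul_lt_mul_of_pos_left h2 h3
      _ = g T := by rw [hgT, ← heδ]; ring
  -- the projected displacement, frozen outside `[0, T]`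
  set p : ℝ → ℝ := fun t => max 0 (min t T) with hp
  have hp0 : ∀ t, 0 ≤ p t := fun t => le_max_left _ _
  have hpe : ∀ t, 0 ≤ t → t ≤ T → p t = t := fun t h0 h1 => by simp [hp, h0, h1]
  set f : ℝ → ℝ := fun t => g (p t) - g 0 with hf
  have hfc : Continuous f :=
    (hgc.comp_continuous (by fun_prop) hp0).sub continuous_const
  obtain ⟨B, hB⟩ : ∃ B, ∀ t, |f t| ≤ B := by
    obtain ⟨B, hB⟩ := (isCompact_Icc (a := (0 : ℝ)) (b := T)).exists_bound_of_continuousOn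
      hfc.continuousOn
    refine ⟨B, fun t => ?_⟩
    have hpm : p t ∈ Icc 0 T := ⟨hp0 t, max_le hT.le (min_le_right _ _)⟩
    have := hB (p t) hpm
    simpa only [hf, hpe _ hpm.1 hpm.2, Real.norm_eq_abs] using this
  have hf0 : ∀ t ≤ 0, f t = 0 := fun t ht => by
    have : p t = 0 := max_eq_left ((min_le_left _ _).trans ht)
    simp [hf, this]
  have hfmax : ∀ t < T, f t < f T := fun t ht => by
    have : p t < T := max_lt hT (by rw [min_lt_iff]; exact Or.inl ht)
    simpa only [hf, hpe T hT.le le_rfl, sub_lt_sub_iff_right] using hglt _ (hp0 t) this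
  obtain ⟨ε, hε, hεη⟩ := exists_lt_powConv_sub hα hα1 hT hfc hB hf0 hfmax
  have hΓ : 0 < Real.Gamma (1 - α) := Real.Gamma_pos_of_pos (by linarith)
  -- replacing `e` by `y t` costs `C * ‖e - y t‖`, and `⟪y t, v t⟫ ≤ C * (δ - ‖y t‖ ^ 2)`; both bounds
  -- vanish as `t` tends to `T`
  obtain ⟨η, hη, hηT, hηv⟩ : ∃ η > 0, η < T ∧ ∀ t, T - η < t → t < T →
      inner ℝ e (u₁ t - u₂ t) ≤ ε / Real.Gamma (1 - α) := by
    have hyT : ContinuousAt y T := hyc.continuousAt (Ici_mem_nhds hT)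
    have hcont : ContinuousAt (fun t => C * (δ - ‖y t‖ ^ 2) + ‖e - y t‖ * C) T :=
      (continuousAt_const.mul (continuousAt_const.sub (hyT.norm.pow 2))).add
        ((continuousAt_const.sub hyT).norm.mul continuousAt_const)
    have hval : C * (δ - ‖y T‖ ^ 2) + ‖e - y T‖ * C < ε / Real.Gamma (1 - α) := by
      rw [← he, heδ]; simp only [sub_self, mul_zero, norm_zero, zero_mul, add_zero]; positivity
    obtain ⟨w, hw, hwε⟩ := Metric.eventually_nhds_iff.1 (hcont.eventually (gt_mem_nhds hval))
    refine ⟨min w (T / 2), by positivity, by rw [min_lt_iff]; right; linarith,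
      fun t ht htT => ?_⟩
    have htw : T - w < t := by linarith [min_le_left w (T / 2)]
    have ht0 : 0 ≤ t := by linarith [min_le_right w (T / 2)]
    have h1 := hwε (y := t) (by rw [Real.dist_eq, abs_lt]; constructor <;> linarith)
    have h2 := hin t ht0 (hlt t ht0 htT).le
    have h3 : inner ℝ (e - y t) (u₁ t - u₂ t) ≤ ‖e - y t‖ * C :=
      (real_inner_le_norm _ _).trans (mul_le_mul_of_nonneg_left (hu t ht0) (norm_nonneg _))
    rw [inner_sub_left] at h3
    simp only [hy] at h1 h3 ⊢
    linarith
  -- The fractional integral of the difference is split only on `[0, T]`, in `hHp`: at negative times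
  -- nothing is known about the integrability of the two trajectories.
  set H : ℝ → ℝ := fun t =>
    inner ℝ e (fracIntegral (1 - α) (fun s => x₁ s - x₁ 0) t)
      - inner ℝ e (fracIntegral (1 - α) (fun s => x₂ s - x₂ 0) t) with hH
  have hHac : AbsolutelyContinuousOnInterval H 0 T := by
    have : ∀ {x u : ℝ → E}, HasCaputoDeriv α x u → AbsolutelyContinuousOnInterval
        (fun t => inner ℝ e (fracIntegral (1 - α) (fun s => x s - x 0) t)) 0 T := fun h =>
      absolutelyContinuousOnInterval_of_dist_le (C := ‖e‖) (h.absolutelyContinuous T hT)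
        fun s t => by
          rw [Real.dist_eq, ← inner_sub_right, dist_eq_norm]
          exact abs_real_inner_le_norm _ _
    exact (this h₁).fun_sub (this h₂)
  have hHd : ∀ᵐ t : ℝ, 0 < t → HasDerivAt H (inner ℝ e (u₁ t - u₂ t)) t := by
    filter_upwards [h₁.hasDerivAt, h₂.hasDerivAt] with t ht1 ht2 ht
    rw [inner_sub_right]
    exact ((innerSL ℝ e).hasFDerivAt.comp_hasDerivAt t (ht1 ht)).sub
      ((innerSL ℝ e).hasFDerivAt.comp_hasDerivAt t (ht2 ht))
  have hHp : ∀ t, 0 ≤ t → t ≤ T → powConv α T f t = Real.Gamma (1 - α) * H t := fun t ht htT => by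
    have hc : ∀ {x : ℝ → E}, ContinuousOn x (Ici 0) → IntervalIntegrable
        (fun r => r ^ (-α) * inner ℝ e (x (t - r) - x 0)) volume 0 t := fun {x} hx => by
      refine (intervalIntegral.intervalIntegrable_rpow' (by linarith)).mul_continuousOn ?_
      refine continuousOn_const.inner ((hx.comp (by fun_prop) fun r hr => ?_).sub
        continuousOn_const)
      rw [uIcc_of_le ht] at hr
      exact sub_nonneg.2 hr.2
    simp only [hH]
    rw [inner_fracIntegral hα1 (x := fun s => x₁ s - x₁ 0)
        (h₁.continuousOn.sub continuousOn_const) e ht,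
      inner_fracIntegral hα1 (x := fun s => x₂ s - x₂ 0)
        (h₂.continuousOn.sub continuousOn_const) e ht, ← mul_sub,
      mul_inv_cancel_left₀ hΓ.ne', ← intervalIntegral.integral_sub (hc h₁.continuousOn)
        (hc h₂.continuousOn)]
    unfold powConv
    have hi := intervalIntegrable_rpow_neg_mul hα1 (f := fun r => f (t - r)) (by fun_prop)
    rw [← intervalIntegral.integral_add_adjacent_intervals (hi 0 t) (hi t T)]
    have hz : ∫ r in t..T, r ^ (-α) * f (t - r) = ∫ r in t..T, (0 : ℝ) := by
      refine intervalIntegral.integral_congr fun r hr => ?_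
      rw [uIcc_of_le htT] at hr
      simp only [hf0 (t - r) (by linarith [hr.1]), mul_zero]
    rw [hz, intervalIntegral.integral_zero, add_zero]
    refine intervalIntegral.integral_congr fun r hr => ?_
    rw [uIcc_of_le ht] at hr
    simp only [hf, hpe (t - r) (by linarith [hr.2]) (by linarith [hr.1]), hg, hy,
      inner_sub_right]
    ring
  obtain ⟨s, t, hs, hst, htT, hlt'⟩ := hεη η hη
  rw [hHp t (by linarith) htT, hHp s (by linarith) (by linarith), ← mul_sub] at hlt'
  have hle : H t - H s ≤ ε / Real.Gamma (1 - α) * (t - s) := by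
    refine sub_le_of_ae_hasDerivAt_le hst (hHac.mono ?_) ?_
    · rw [uIcc_of_le hst, uIcc_of_le hT.le]
      exact Icc_subset_Icc (by linarith) htT
    · filter_upwards [hHd] with r hr hrm
      exact ⟨_, hηv r (by linarith [hrm.1]) (by linarith [hrm.2]),
        hr (by linarith [hrm.1])⟩
  have := mul_le_mul_of_nonneg_left hle hΓ.le
  rw [← mul_assoc, mul_div_cancel₀ _ hΓ.ne'] at this
  linarith

end Inner

/-- For `α = 1` the extremum principle has no memory term to give strictness; instead Grönwall's
argument shows that `(δ - ‖x₁ - x₂‖ ^ 2) * exp (2 * C * t)` is nondecreasing up to `T`. -/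
theorem not_first_exit_of_one {d : ℕ} {x₁ x₂ u₁ u₂ : ℝ → EuclideanSpace ℝ (Fin d)}
    (h₁ : HasCaputoDeriv 1 x₁ u₁) (h₂ : HasCaputoDeriv 1 x₂ u₂) {δ C : ℝ}
    (hin : ∀ t, 0 ≤ t → ‖x₁ t - x₂ t‖ ^ 2 ≤ δ →
      inner ℝ (x₁ t - x₂ t) (u₁ t - u₂ t) ≤ C * (δ - ‖x₁ t - x₂ t‖ ^ 2))
    {T : ℝ} (hT : 0 < T) (hTδ : ‖x₁ T - x₂ T‖ ^ 2 = δ)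
    (hlt : ∀ s, 0 ≤ s → s < T → ‖x₁ s - x₂ s‖ ^ 2 < δ) : False := by
  have hfr : ∀ x : ℝ → EuclideanSpace ℝ (Fin d), fracIntegral (1 - 1) x = x := fun x => by
    funext t; simp [fracIntegral]
  have hac : ∀ {x u : ℝ → EuclideanSpace ℝ (Fin d)}, HasCaputoDeriv 1 x u → ∀ c,
      AbsolutelyContinuousOnInterval (fun t => x t c) 0 T := fun {x u} h c => by
    have := h.absolutelyContinuous T hT
    rw [hfr] at this
    refine absolutelyContinuousOnInterval_of_dist_le (C := 1) this fun s t => ?_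
    rw [dist_sub_right, one_mul, dist_eq_norm, dist_eq_norm]
    exact PiLp.norm_apply_le (x s - x t) c
  have hder : ∀ {x u : ℝ → EuclideanSpace ℝ (Fin d)}, HasCaputoDeriv 1 x u →
      ∀ᵐ t : ℝ, 0 < t → HasDerivAt x (u t) t := fun {x u} h => by
    filter_upwards [h.hasDerivAt] with t ht h0
    have := ht h0
    rw [hfr] at this
    simpa using this.add_const (x 0)
  set W : ℝ → ℝ := fun t => (‖x₁ t - x₂ t‖ ^ 2 - δ) * Real.exp (2 * C * t) with hW
  have hWac : AbsolutelyContinuousOnInterval W 0 T := by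
    have hsum : ∀ s : Finset (Fin d), AbsolutelyContinuousOnInterval
        (fun t => (∑ c ∈ s, (x₁ t c - x₂ t c) * (x₁ t c - x₂ t c)) + -δ) 0 T := fun s => by
      induction s using Finset.induction_on with
      | empty =>
        simp only [Finset.sum_empty]
        exact ContDiffOn.absolutelyContinuousOnInterval contDiffOn_const
      | insert c s hc ih =>
        simp only [Finset.sum_insert hc, add_assoc]
        have hcc := (hac h₁ c).fun_sub (hac h₂ c)
        exact (hcc.fun_mul hcc).fun_add ih
    have hexp : AbsolutelyContinuousOnInterval (fun t => Real.exp (2 * C * t)) 0 T :=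
      ContDiffOn.absolutelyContinuousOnInterval (by fun_prop)
    have := (hsum Finset.univ).fun_mul hexp
    refine (funext fun t => ?_ : W = _) ▸ this
    simp only [hW]
    rw [EuclideanSpace.real_norm_sq_eq]
    simp only [PiLp.sub_apply]
    ring_nf
  have hle : W T - W 0 ≤ 0 * (T - 0) := by
    refine sub_le_of_ae_hasDerivAt_le hT.le hWac ?_
    filter_upwards [hder h₁, hder h₂] with t h1 h2 ht
    have hexp : HasDerivAt (fun t => Real.exp (2 * C * t))
        (Real.exp (2 * C * t) * (2 * C * 1)) t :=
      ((hasDerivAt_id t).const_mul (2 * C)).exp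
    refine ⟨_, ?_, ((((h1 ht.1).sub (h2 ht.1)).norm_sq).sub_const δ).mul hexp⟩
    have hi := hin t ht.1.le (hlt t ht.1.le ht.2).le
    have he := Real.exp_pos (2 * C * t)
    simp only [Pi.sub_apply]
    nlinarith
  have h0 := hlt 0 le_rfl hT
  simp only [hW, hTδ, sub_self, zero_mul, mul_zero, Real.exp_zero, mul_one] at hle
  linarith

/-- The open ball is invariant for the difference of two fractional trajectories with bounded
relative input that grows outwards at most linearly in the distance to the boundary. -/
theorem norm_sub_sq_lt_of_inner_le {d : ℕ} {α : ℝ} (hα : 0 < α) (hα1 : α ≤ 1)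
    {x₁ x₂ u₁ u₂ : ℝ → EuclideanSpace ℝ (Fin d)}
    (h₁ : HasCaputoDeriv α x₁ u₁) (h₂ : HasCaputoDeriv α x₂ u₂) {δ C : ℝ}
    (hu : ∀ t, 0 ≤ t → ‖u₁ t - u₂ t‖ ≤ C)
    (hin : ∀ t, 0 ≤ t → ‖x₁ t - x₂ t‖ ^ 2 ≤ δ →
      inner ℝ (x₁ t - x₂ t) (u₁ t - u₂ t) ≤ C * (δ - ‖x₁ t - x₂ t‖ ^ 2))
    (h0 : ‖x₁ 0 - x₂ 0‖ ^ 2 < δ) {t : ℝ} (ht : 0 ≤ t) : ‖x₁ t - x₂ t‖ ^ 2 < δ := by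
  by_contra! hcon
  obtain ⟨T, hT, hTδ, hlt⟩ := exists_first_exit
    ((h₁.continuousOn.sub h₂.continuousOn).norm.pow 2) h0 ht hcon
  rcases hα1.lt_or_eq with h | rfl
  · exact not_first_exit_of_lt_one hα h h₁ h₂ hu hin hT hTδ hlt
  · exact not_first_exit_of_one h₁ h₂ hin hT hTδ hlt

/-! ### The gradient of the potential -/

section Potential

variable {V : Type*} {d : ℕ}

theorem hasFDerivAt_norm_sub_sq (p x : EuclideanSpace ℝ (Fin d)) :
    HasFDerivAt (fun y => ‖y - p‖ ^ 2) ((2 : ℝ) • innerSL ℝ (x - p)) x := by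
  have := ((hasFDerivAt_id x).sub_const p).norm_sq
  refine this.congr_fderiv ?_
  ext w
  simp

theorem hasFDerivAt_goal (N : Finset V) (q : V → EuclideanSpace ℝ (Fin d))
    (x : EuclideanSpace ℝ (Fin d)) :
    HasFDerivAt (goal N q) (innerSL ℝ (∑ l ∈ N, (x - q l))) x := by
  have := HasFDerivAt.fun_sum (u := N) fun l _ =>
    (hasFDerivAt_norm_sub_sq (q l) x).const_mul (1 / 2 : ℝ)
  refine this.congr_fderiv ?_
  ext w
  simp

open Classical in
theorem hasFDerivAt_constraint (δ : ℝ) (N : Finset V) (q : V → EuclideanSpace ℝ (Fin d))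
    (x : EuclideanSpace ℝ (Fin d)) :
    HasFDerivAt (constraint δ N q)
      (innerSL ℝ (-∑ l ∈ N, (∏ m ∈ N.erase l, (δ - ‖x - q m‖ ^ 2)) • (x - q l))) x := by
  have := (HasFDerivAt.finsetProd (u := N) fun l _ =>
    (hasFDerivAt_norm_sub_sq (q l) x).const_sub δ).const_mul (1 / 2 : ℝ)
  refine this.congr_fderiv ?_
  ext w
  simp only [smul_apply, sum_apply,
    neg_apply, innerSL_apply_apply, smul_eq_mul, inner_neg_left, sum_inner,
    inner_smul_left, Finset.mul_sum, ← Finset.sum_neg_distrib, conj_trivial]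
  refine Finset.sum_congr rfl fun l _ => ?_
  ring

theorem goal_nonneg (N : Finset V) (q : V → EuclideanSpace ℝ (Fin d))
    (x : EuclideanSpace ℝ (Fin d)) : 0 ≤ goal N q x :=
  Finset.sum_nonneg fun _ _ => by positivity

theorem sq_dist_le_of_mem {N : Finset V} (q : V → EuclideanSpace ℝ (Fin d))
    (x : EuclideanSpace ℝ (Fin d)) {l : V} (hl : l ∈ N) : ‖x - q l‖ ^ 2 ≤ 2 * goal N q x := by
  have := Finset.single_le_sum (f := fun j => (1 / 2 : ℝ) * ‖x - q j‖ ^ 2)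
    (fun _ _ => by positivity) hl
  simp only [goal]
  linarith

theorem prod_bond_nonneg {δ : ℝ} {N : Finset V} {q : V → EuclideanSpace ℝ (Fin d)}
    {x : EuclideanSpace ℝ (Fin d)} (h : ∀ l ∈ N, ‖x - q l‖ ^ 2 ≤ δ) :
    0 ≤ ∏ m ∈ N, (δ - ‖x - q m‖ ^ 2) :=
  Finset.prod_nonneg fun l hl => sub_nonneg.2 (h l hl)

theorem constraint_nonneg {δ : ℝ} {N : Finset V} {q : V → EuclideanSpace ℝ (Fin d)}
    {x : EuclideanSpace ℝ (Fin d)} (h : ∀ l ∈ N, ‖x - q l‖ ^ 2 ≤ δ) :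
    0 ≤ constraint δ N q x :=
  mul_nonneg (by norm_num) (prod_bond_nonneg h)

open Classical in
/-- The gradient of the potential in the own state, as a combination of the relative states whose
weights are nonnegative when all the bonds are. -/
def potentialGradient (δ k : ℝ) (N : Finset V) (q : V → EuclideanSpace ℝ (Fin d))
    (x : EuclideanSpace ℝ (Fin d)) : EuclideanSpace ℝ (Fin d) :=
  ∑ l ∈ N, ((goal N q x ^ k + constraint δ N q x) ^ (-(1 / k) - 1) *
    (constraint δ N q x + goal N q x / k * ∏ m ∈ N.erase l, (δ - ‖x - q m‖ ^ 2))) • (x - q l)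

/-- At a point where the goal function vanishes, `goal ^ k` need not be differentiable (`k` may be
small), but there the goal function is `o(‖y - x‖)` and the potential is its product with a
continuous function. Elsewhere the product and chain rules give the formula. -/
theorem gradient_potential {δ k : ℝ} (hk : 0 < k) {N : Finset V}
    {q : V → EuclideanSpace ℝ (Fin d)} {x : EuclideanSpace ℝ (Fin d)}
    (hP : 0 < goal N q x ^ k + constraint δ N q x) :
    gradient (potential δ k N q) x = potentialGradient δ k N q x := by
  classical
  refine HasGradientAt.gradient ?_
  rw [hasGradientAt_iff_hasFDerivAt]
  have hγ := hasFDerivAt_goal N q x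
  have hβ := hasFDerivAt_constraint δ N q x
  set P : EuclideanSpace ℝ (Fin d) → ℝ := fun y => goal N q y ^ k + constraint δ N q y with hPdef
  have hPc : ContinuousAt P x :=
    (hγ.continuousAt.rpow_const (Or.inr hk.le)).add hβ.continuousAt
  have hPx : 0 < P x := hP
  have heq : potential δ k N q =ᶠ[nhds x] fun y => goal N q y * P y ^ (-(1 / k)) := by
    filter_upwards [hPc.eventually (lt_mem_nhds hPx)] with y hy
    rw [Real.rpow_neg hy.le, potential, div_eq_mul_inv]
  refine HasFDerivAt.congr_of_eventuallyEq ?_ heq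
  rcases (goal_nonneg N q x).eq_or_lt with h0 | h0
  · have hxq : ∀ l ∈ N, x - q l = 0 := fun l hl => by
      have := sq_dist_le_of_mem q x hl
      rw [← h0, mul_zero] at this
      simpa using le_antisymm this (by positivity)
    have hg0 : potentialGradient δ k N q x = 0 :=
      Finset.sum_eq_zero fun l hl => by rw [hxq l hl, smul_zero]
    have hs0 : ∑ l ∈ N, (x - q l) = 0 := Finset.sum_eq_zero hxq
    rw [hs0, map_zero, hasFDerivAt_iff_isLittleO] at hγ
    rw [hg0, map_zero, hasFDerivAt_iff_isLittleO]
    have hQ : ContinuousAt (fun y => P y ^ (-(1 / k))) x :=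
      hPc.rpow_const (Or.inl hPx.ne')
    have := hγ.norm_right.mul_isBigO (hQ.isBigO_one ℝ)
    simpa only [← h0, zero_mul, sub_zero, zero_apply, mul_one,
      Asymptotics.isLittleO_norm_right] using this
  · have hPd : HasFDerivAt P _ x := (hγ.rpow_const (p := k) (Or.inl h0.ne')).add hβ
    refine (hγ.mul (hPd.rpow_const (p := -(1 / k)) (Or.inl hPx.ne'))).congr_fderiv ?_
    ext w
    have e1 : P x ^ (-(1 / k)) = P x ^ (-(1 / k) - 1) * P x := by
      rw [Real.rpow_sub_one hPx.ne', div_mul_cancel₀ _ hPx.ne']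
    have e2 : goal N q x ^ (k - 1) = goal N q x ^ k / goal N q x := Real.rpow_sub_one h0.ne' k
    simp only [add_apply, smul_apply, innerSL_apply_apply,
      InnerProductSpace.toDual_apply_apply, smul_eq_mul, inner_neg_left, sum_inner,
      inner_smul_left, conj_trivial, potentialGradient, mul_add, add_mul, mul_assoc,
      Finset.sum_add_distrib, ← Finset.mul_sum]
    rw [e1, e2]
    change _ = P x ^ (-(1 / k) - 1) * _ + P x ^ (-(1 / k) - 1) * _
    have hPv : P x = goal N q x ^ k + constraint δ N q x := rfl
    set A := P x ^ (-(1 / k) - 1)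
    rw [hPv]
    field_simp
    ring

/-! ### Uniform bounds on the influence -/

variable [Fintype V]

theorem prod_bond_le {δ : ℝ} {N : Finset V} {q : V → EuclideanSpace ℝ (Fin d)}
    {x : EuclideanSpace ℝ (Fin d)} (h : ∀ l ∈ N, ‖x - q l‖ ^ 2 ≤ δ) :
    ∏ m ∈ N, (δ - ‖x - q m‖ ^ 2) ≤ max δ 1 ^ Fintype.card V :=
  calc ∏ m ∈ N, (δ - ‖x - q m‖ ^ 2) ≤ ∏ _m ∈ N, max δ 1 :=
        Finset.prod_le_prod (fun l hl => sub_nonneg.2 (h l hl)) fun l _ =>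
          (sub_le_self _ (by positivity)).trans (le_max_left _ _)
    _ = max δ 1 ^ N.card := Finset.prod_const _
    _ ≤ max δ 1 ^ Fintype.card V := pow_le_pow_right₀ (le_max_right _ _) (Finset.card_le_univ N)

theorem goal_le {δ : ℝ} (hδ : 0 < δ) {N : Finset V} {q : V → EuclideanSpace ℝ (Fin d)}
    {x : EuclideanSpace ℝ (Fin d)} (h : ∀ l ∈ N, ‖x - q l‖ ^ 2 ≤ δ) :
    goal N q x ≤ Fintype.card V * δ :=
  calc goal N q x ≤ N.card • δ := Finset.sum_le_card_nsmul _ _ _ fun l hl => by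
        linarith [h l hl]
    _ ≤ Fintype.card V * δ := by
        rw [nsmul_eq_mul]
        exact mul_le_mul_of_nonneg_right (by exact_mod_cast Finset.card_le_univ N) hδ.le

/-- The base of the denominator of the potential is bounded away from zero: if the goal function is
below `δ / 4`, then every neighbor is at squared distance at most `δ / 2` and the constraint
function is large. -/
theorem le_goal_rpow_add_constraint {δ k : ℝ} (hδ : 0 < δ) (hk : 0 < k) {N : Finset V}
    {q : V → EuclideanSpace ℝ (Fin d)} {x : EuclideanSpace ℝ (Fin d)}
    (h : ∀ l ∈ N, ‖x - q l‖ ^ 2 ≤ δ) :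
    min ((δ / 4) ^ k) (1 / 2 * min (δ / 2) 1 ^ Fintype.card V)
      ≤ goal N q x ^ k + constraint δ N q x := by
  rcases le_or_gt (δ / 4) (goal N q x) with hg | hg
  · refine (min_le_left _ _).trans ?_
    have := Real.rpow_le_rpow (by positivity) hg hk.le
    linarith [constraint_nonneg h]
  · refine (min_le_right _ _).trans ?_
    have hμ : 0 < min (δ / 2) 1 := by positivity
    have h1 : min (δ / 2) 1 ^ Fintype.card V ≤ ∏ m ∈ N, (δ - ‖x - q m‖ ^ 2) :=
      calc min (δ / 2) 1 ^ Fintype.card V ≤ min (δ / 2) 1 ^ N.card :=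
            pow_le_pow_of_le_one hμ.le (min_le_right _ _) (Finset.card_le_univ N)
        _ = ∏ _m ∈ N, min (δ / 2) 1 := (Finset.prod_const _).symm
        _ ≤ ∏ m ∈ N, (δ - ‖x - q m‖ ^ 2) := Finset.prod_le_prod (fun _ _ => hμ.le) fun l hl =>
            (min_le_left _ _).trans (by linarith [sq_dist_le_of_mem q x hl])
    have h2 := Real.rpow_nonneg (goal_nonneg N q x) k
    simp only [constraint]
    linarith

/-- The constant does not depend on the neighbor set. Of the terms of the gradient, that of `j` itself
is attractive, and the others are small when `‖x - q j‖ ^ 2` is close to `δ`. -/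
theorem exists_gradient_potential_bound {δ k : ℝ} (hδ : 0 < δ) (hk : 0 < k) :
    ∃ C, 0 ≤ C ∧ ∀ (N : Finset V) (q : V → EuclideanSpace ℝ (Fin d))
      (x : EuclideanSpace ℝ (Fin d)), (∀ l ∈ N, ‖x - q l‖ ^ 2 ≤ δ) →
      ‖gradient (potential δ k N q) x‖ ≤ C ∧
      ∀ j ∈ N, -inner ℝ (x - q j) (gradient (potential δ k N q) x) ≤ C * (δ - ‖x - q j‖ ^ 2) := by
  classical
  set n : ℝ := (Fintype.card V : ℝ) with hn
  set D : ℝ := max δ 1 with hD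
  have hD1 : 1 ≤ D := le_max_right _ _
  set p : ℝ := min ((δ / 4) ^ k) (1 / 2 * min (δ / 2) 1 ^ Fintype.card V) with hp
  have hp0 : 0 < p := by positivity
  set A : ℝ := p ^ (-(1 / k) - 1) with hA
  set W : ℝ := D ^ Fintype.card V + n * δ / k * D ^ Fintype.card V with hW
  have hW0 : 0 ≤ W := by positivity
  have hA0 : 0 ≤ A := by positivity
  refine ⟨n * (A * W * (D * D)), by positivity, fun N q x h => ?_⟩
  have hpP := le_goal_rpow_add_constraint hδ hk h
  have hP := hp0.trans_le hpP
  rw [gradient_potential hk hP]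
  set P := goal N q x ^ k + constraint δ N q x with hPdef
  have hPA : P ^ (-(1 / k) - 1) ≤ A := Real.rpow_le_rpow_of_nonpos hp0 hpP (by
    have : 0 < 1 / k := by positivity
    linarith)
  have hPA0 : 0 ≤ P ^ (-(1 / k) - 1) := by positivity
  have hγ0 : 0 ≤ goal N q x / k := div_nonneg (goal_nonneg N q x) hk.le
  have hγk : goal N q x / k ≤ n * δ / k := by
    have := goal_le hδ h
    gcongr
  have hnorm : ∀ l ∈ N, ‖x - q l‖ ≤ D := fun l hl => by
    refine le_of_sq_le_sq ?_ (by linarith)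
    nlinarith [h l hl, le_max_left δ 1]
  set w : V → ℝ := fun l =>
    constraint δ N q x + goal N q x / k * ∏ m ∈ N.erase l, (δ - ‖x - q m‖ ^ 2) with hw
  have herase : ∀ (M : Finset V) (l : V), (∀ m ∈ M, ‖x - q m‖ ^ 2 ≤ δ) →
      ∀ m ∈ M.erase l, ‖x - q m‖ ^ 2 ≤ δ := fun M l hM m hm => hM m (Finset.mem_of_mem_erase hm)
  have hw0 : ∀ l, 0 ≤ w l := fun l =>
    add_nonneg (constraint_nonneg h) (mul_nonneg hγ0 (prod_bond_nonneg (herase N l h)))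
  have hwW : ∀ l, w l ≤ W := fun l => by
    refine add_le_add ?_ (mul_le_mul hγk (prod_bond_le (herase N l h))
      (prod_bond_nonneg (herase N l h)) (by positivity))
    have := prod_bond_le h
    have := prod_bond_nonneg h
    simp only [constraint]
    linarith
  -- every other weight carries the factor `δ - ‖x - q j‖ ^ 2`
  have hwb : ∀ j ∈ N, ∀ l ∈ N, l ≠ j → w l ≤ W * (δ - ‖x - q j‖ ^ 2) := fun j hj l hl hlj => by
    have hb : 0 ≤ δ - ‖x - q j‖ ^ 2 := sub_nonneg.2 (h j hj)
    have e1 := Finset.mul_prod_erase N (fun m => δ - ‖x - q m‖ ^ 2) hj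
    have e2 := Finset.mul_prod_erase (N.erase l) (fun m => δ - ‖x - q m‖ ^ 2)
      (Finset.mem_erase.2 ⟨hlj.symm, hj⟩)
    have b1 := prod_bond_le (herase N j h)
    have b2 := prod_bond_le (herase _ j (herase N l h))
    have p1 := prod_bond_nonneg (herase N j h)
    have p2 := prod_bond_nonneg (herase _ j (herase N l h))
    simp only [hw, constraint]
    rw [← e1, ← e2, hW, add_mul]
    refine add_le_add ?_ ?_
    · nlinarith
    · rw [mul_left_comm, mul_comm (_ * _) (δ - _)]
      exact mul_le_mul_of_nonneg_left (mul_le_mul hγk b2 p2 (by positivity)) hb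
  have hcard : (N.card : ℝ) ≤ n := Nat.cast_le.2 (Finset.card_le_univ N)
  constructor
  · calc ‖potentialGradient δ k N q x‖ ≤ N.card • (A * W * D) :=
          norm_sum_le_of_le _ (fun l hl => ?_) |>.trans (Finset.sum_const _).le
      _ ≤ n * (A * W * (D * D)) := by
          rw [nsmul_eq_mul]
          have : A * W * D ≤ A * W * (D * D) :=
            mul_le_mul_of_nonneg_left (by nlinarith) (by positivity)
          exact mul_le_mul hcard this (by positivity) (by positivity)
    rw [norm_smul, Real.norm_of_nonneg (mul_nonneg hPA0 (hw0 l))]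
    exact mul_le_mul (mul_le_mul hPA (hwW l) (hw0 l) hA0) (hnorm l hl) (norm_nonneg _)
      (by positivity)
  · intro j hj
    have hb : 0 ≤ δ - ‖x - q j‖ ^ 2 := sub_nonneg.2 (h j hj)
    simp only [potentialGradient, inner_sum, ← Finset.sum_neg_distrib]
    calc ∑ l ∈ N, -inner ℝ (x - q j) ((P ^ (-(1 / k) - 1) * w l) • (x - q l))
        ≤ N.card • (A * W * (D * D) * (δ - ‖x - q j‖ ^ 2)) :=
          Finset.sum_le_card_nsmul _ _ _ fun l hl => ?_
      _ ≤ n * (A * W * (D * D)) * (δ - ‖x - q j‖ ^ 2) := by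
          rw [nsmul_eq_mul, mul_assoc n]
          exact mul_le_mul_of_nonneg_right hcard (by positivity)
    rw [inner_smul_right, ← mul_neg]
    rcases eq_or_ne l j with rfl | hlj
    · rw [real_inner_self_eq_norm_sq]
      have h1 : P ^ (-(1 / k) - 1) * w l * -‖x - q l‖ ^ 2 ≤ 0 :=
        mul_nonpos_of_nonneg_of_nonpos (mul_nonneg hPA0 (hw0 l)) (by
          have := sq_nonneg ‖x - q l‖
          linarith)
      exact h1.trans (by positivity)
    · have h1 : -inner ℝ (x - q j) (x - q l) ≤ D * D := by
        have := abs_real_inner_le_norm (x - q j) (x - q l)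
        have h2 : ‖x - q j‖ * ‖x - q l‖ ≤ D * D :=
          mul_le_mul (hnorm j hj) (hnorm l hl) (norm_nonneg _) (by linarith)
        linarith [(abs_le.1 this).1]
      calc P ^ (-(1 / k) - 1) * w l * -inner ℝ (x - q j) (x - q l)
          ≤ P ^ (-(1 / k) - 1) * w l * (D * D) :=
            mul_le_mul_of_nonneg_left h1 (mul_nonneg hPA0 (hw0 l))
        _ ≤ A * (W * (δ - ‖x - q j‖ ^ 2)) * (D * D) :=
            mul_le_mul_of_nonneg_right
              (mul_le_mul hPA (hwb j hj l hl hlj) (hw0 l) hA0) (by positivity)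
        _ = A * W * (D * D) * (δ - ‖x - q j‖ ^ 2) := by ring

theorem exists_influence_bound {F : Finset V} {δ k : ℝ} (hδ : 0 < δ) (hk : 0 < k) {K : V → ℝ}
    (hK : ∀ i ∈ F, 0 < K i) :
    ∃ C, ∀ (q : V → EuclideanSpace ℝ (Fin d)) (i : V), ‖influence F δ k K q i‖ ≤ C ∧
      ∀ j, j ≠ i → socialDiff q i j ≤ δ →
        inner ℝ (q i - q j) (influence F δ k K q i) ≤ C * (δ - socialDiff q i j) := by
  classical
  obtain ⟨C, hC, h⟩ := exists_gradient_potential_bound (V := V) (d := d) hδ hk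
  have hκ : ∀ i ∈ F, K i ≤ ∑ i ∈ F, K i := fun i hi =>
    Finset.single_le_sum (fun j hj => (hK j hj).le) hi
  have hκ0 : 0 ≤ ∑ i ∈ F, K i := Finset.sum_nonneg fun j hj => (hK j hj).le
  refine ⟨(∑ i ∈ F, K i) * C, fun q i => ?_⟩
  by_cases hi : i ∈ F
  · have hN : ∀ l ∈ neighbors δ q i, ‖q i - q l‖ ^ 2 ≤ δ := fun l hl =>
      (Finset.mem_filter.1 hl).2.2
    obtain ⟨h1, h2⟩ := h (neighbors δ q i) q (q i) hN
    simp only [influence, if_pos hi]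
    refine ⟨?_, fun j hji hj => ?_⟩
    · rw [norm_neg, norm_smul, Real.norm_of_nonneg (hK i hi).le]
      exact mul_le_mul (hκ i hi) h1 (norm_nonneg _) hκ0
    · have hjN : j ∈ neighbors δ q i := Finset.mem_filter.2 ⟨Finset.mem_univ _, hji, hj⟩
      have hb : 0 ≤ C * (δ - socialDiff q i j) := mul_nonneg hC (sub_nonneg.2 hj)
      rw [inner_neg_right, inner_smul_right, ← mul_neg, mul_assoc]
      exact (mul_le_mul_of_nonneg_left (h2 j hjN) (hK i hi).le).trans
        (mul_le_mul_of_nonneg_right (hκ i hi) hb)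
  · simp only [influence, if_neg hi, norm_zero, inner_zero_right]
    exact ⟨by positivity, fun j _ hj =>
      mul_nonneg (mul_nonneg hκ0 hC) (sub_nonneg.2 hj)⟩

/-- If `i` and `j` are within the threshold, each is a neighbor of the other, and their two inward
estimates add up; a leader contributes zero. -/
theorem socialDiff_lt {F : Finset V} {α : ℝ} (hα : 0 < α) (hα1 : α ≤ 1) {δ : ℝ} (hδ : 0 < δ)
    {k : ℝ} (hk : 0 < k) {K : V → ℝ} (hK : ∀ i ∈ F, 0 < K i)
    {q : ℝ → V → EuclideanSpace ℝ (Fin d)} (hq : IsClosedLoop F α δ k K q) {i j : V}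
    (hij : j ≠ i) (h0 : socialDiff (q 0) i j < δ) {t : ℝ} (ht : 0 ≤ t) :
    socialDiff (q t) i j < δ := by
  obtain ⟨C, hC⟩ := exists_influence_bound (d := d) hδ hk hK
  refine norm_sub_sq_lt_of_inner_le (C := 2 * C) hα hα1 (hq i) (hq j) (fun s _ => ?_)
    (fun s _ hs => ?_) h0 ht
  · have := norm_sub_le (influence F δ k K (q s) i) (influence F δ k K (q s) j)
    linarith [(hC (q s) i).1, (hC (q s) j).1]
  · have hcomm : socialDiff (q s) j i = socialDiff (q s) i j := by
      simp only [socialDiff, norm_sub_rev]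
    have h1 := (hC (q s) i).2 j hij hs
    have h2 := (hC (q s) j).2 i hij.symm (hcomm.trans_le hs)
    rw [hcomm, ← neg_sub (q s i), inner_neg_left] at h2
    rw [inner_sub_right]
    simp only [socialDiff] at h1 h2
    linarith

end Potential

/-! ### Spanning trees rooted at the leaders -/

section Tree

variable {V : Type*}

/-- There is a chain of `n` edges of `G` from `i` up to some leader. -/
def LeaderChain (F : Finset V) (G : Digraph V) : ℕ → V → Prop
  | 0, i => i ∉ F
  | n + 1, i => ∃ j, G.Adj i j ∧ LeaderChain F G n j

theorem exists_leaderChain {F : Finset V} {G : Digraph V} {l i : V} (hl : l ∉ F)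
    (h : InfluencePath G l i) : ∃ n, LeaderChain F G n i := by
  induction h with
  | single h => exact ⟨1, l, h, hl⟩
  | tail _ h ih =>
    obtain ⟨n, hn⟩ := ih
    exact ⟨n + 1, _, h, hn⟩

open Classical in
/-- Each follower takes as its parent the second node of a shortest chain to the leaders. -/
theorem exists_isSpanningTree {F : Finset V} {G : Digraph V}
    (hpath : ∀ i ∈ F, ∃ l, l ∉ F ∧ InfluencePath G l i) : ∃ T, IsSpanningTree F G T := by
  have hex : ∀ i, ∃ n, LeaderChain F G n i := fun i => by
    by_cases hi : i ∈ F
    · obtain ⟨l, hl, hp⟩ := hpath i hi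
      exact exists_leaderChain hl hp
    · exact ⟨0, hi⟩
  have hpar : ∀ i, ∃ j, i ∈ F → G.Adj i j ∧ Nat.find (hex j) < Nat.find (hex i) := fun i => by
    by_cases hi : i ∈ F
    · have hspec := Nat.find_spec (hex i)
      rcases hr : Nat.find (hex i) with _ | n
      · rw [hr] at hspec
        exact absurd hi hspec
      · rw [hr] at hspec
        obtain ⟨j, hj, hn⟩ := hspec
        exact ⟨j, fun _ => ⟨hj, Nat.lt_succ_of_le (Nat.find_le hn)⟩⟩
    · exact ⟨i, fun h => absurd h hi⟩
  choose p hp using hpar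
  refine ⟨⟨fun i j => i ∈ F ∧ j = p i⟩, ?_, fun i hi => ⟨p i, ⟨hi, rfl⟩, fun j hj => hj.2⟩,
    fun i hi j hj => hi hj.1, ?_⟩
  · rintro i j ⟨hi, rfl⟩
    exact (hp i hi).1
  · intro i
    induction hr : Nat.find (hex i) using Nat.strong_induction_on generalizing i with
    | _ n ih =>
      intro hi
      by_cases hpi : p i ∈ F
      · obtain ⟨l, hl, hlp⟩ := ih _ (hr ▸ (hp i hi).2) (p i) rfl hpi
        exact ⟨l, hl, hlp.tail ⟨hi, rfl⟩⟩
      · exact ⟨p i, hpi, .single ⟨hi, rfl⟩⟩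

end Tree

end SocialNetwork

end

theorem theorem1 {V : Type*} [Fintype V] {d : ℕ} (F : Finset V)
    (α : ℝ) (hα : 0 < α) (hα1 : α ≤ 1) (δ : ℝ) (hδ : 0 < δ) (k : ℝ) (hk : 0 < k)
    (K : V → ℝ) (hK : ∀ i ∈ F, 0 < K i)
    (q : ℝ → V → EuclideanSpace ℝ (Fin d))
    (hq : SocialNetwork.IsClosedLoop F α δ k K q)
    -- the bonds `b_ij = δ - S_ij` of the initial edges are positive
    (hb : ∀ i j, (SocialNetwork.graph F δ (q 0)).Adj i j →
      0 < δ - SocialNetwork.socialDiff (q 0) i j)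
    -- every follower is reached by a directed path from some leader in the initial graph
    (hpath : ∀ i ∈ F, ∃ l, l ∉ F ∧
      SocialNetwork.InfluencePath (SocialNetwork.graph F δ (q 0)) l i) :
    (∀ i j, (SocialNetwork.graph F δ (q 0)).Adj i j →
      ∀ t : ℝ, 0 ≤ t → SocialNetwork.socialDiff (q t) i j ≤ δ ∧
        (SocialNetwork.graph F δ (q t)).Adj i j) ∧
    (∃ T, SocialNetwork.IsSpanningTree F (SocialNetwork.graph F δ (q 0)) T) ∧
    (∀ T, SocialNetwork.IsSpanningTree F (SocialNetwork.graph F δ (q 0)) T →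
      ∀ t : ℝ, 0 ≤ t → SocialNetwork.IsSpanningTree F (SocialNetwork.graph F δ (q t)) T) := by

  have hkeep : ∀ i j, (SocialNetwork.graph F δ (q 0)).Adj i j →
      ∀ t : ℝ, 0 ≤ t → (SocialNetwork.graph F δ (q t)).Adj i j := fun i j h t ht =>
    ⟨h.1, h.2.1,
      (SocialNetwork.socialDiff_lt hα hα1 hδ hk hK hq h.2.1 (sub_pos.1 (hb i j h)) ht).le⟩
  refine ⟨fun i j h t ht => ⟨(hkeep i j h t ht).2.2, hkeep i j h t ht⟩,
    SocialNetwork.exists_isSpanningTree hpath, fun T hT t ht => ?_⟩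
  exact ⟨fun i j h => hkeep i j (hT.le h) t ht, hT.existsUnique_parent, hT.leader_no_parent,
    hT.reachable⟩
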